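/- There is an absolute constant $C>0$ such that for all real numbers $K, L$ and $q>4$ there is a constant $C_{K,L,q}>0$, depending only on $K,L,q$, with the following property. Let $X_1,\ldots,X_N$ be independent random vectors in $\mathbb{R}^n$, defined on a common probability space, such that for every $i$ $$\|X_i\|_2 \le K\sqrt n \ \text{ almost surely}, \qquad \big(\mathbb{E}|\langle X_i,x\rangle|^q\big)^{1/q}\le L \ \text{ for all } x\in\mathbb{R}^n \text{ with } \|x\|_2=1,$$ and let $A$ be the random $N\times n$ matrix with rows $X_1,\ldots,X_N$. Then for every $t\ge 1$, with probability at least $1-Ct^{-0.9q}$ the following holds: for every index set $I\subseteq\{1,\ldots,N\}$, $$\|P_I A\|_{\ell_2\to\ell_{2,\infty}}\le C_{K,L,q}\Big[\sqrt n+t\sqrt{|I|}\,\big(N/|I|\big)^{2/q}\Big]$$ (for $I=\emptyset$ the second term is read as $0$); in particular, on the same event, $$\|A\|_{\ell_2\to\ell_{2,\infty}}\le C_{K,L,q}\big(\sqrt n+t\sqrt N\big).$$ Here $P_I$ is the coordinate projection in $\mathbb{R}^N$ onto $\mathbb{R}^I$. For $y\in\mathbb{R}^N$, the weak $\ell_2$-norm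 $\|y\|_{2,\infty}$ is the minimal $M\ge 0$ such that the non-increasing rearrangement $(y_k^*)$ of $(|y_k|)$ satisfies $y_k^*\le Mk^{-1/2}$ for $k=1,\ldots,N$. For a linear map $B:\mathbb{R}^n\to\mathbb{R}^N$, $\|B\|_{\ell_2\to\ell_{2,\infty}}$ is the minimal $M\ge 0$ such that $\|Bx\|_{2,\infty}\le M\|x\|_2$ for all $x\in\mathbb{R}^n$. -/

import Mathlib

open MeasureTheory ProbabilityTheory

noncomputable section

/-- The non-increasing rearrangement `x*` of the sequence `(|x i|)`. Indices start at `0`, so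
the value at `k` is the `(k + 1)`-th largest of the numbers `|x i|`. -/
def decreasingRearrangement {N : ℕ} (x : Fin N → ℝ) (k : Fin N) : ℝ :=
  |x (Tuple.sort (fun i => -|x i|) k)|

theorem decreasingRearrangement_antitone {N : ℕ} (x : Fin N → ℝ) :
    Antitone (decreasingRearrangement x) := by
  intro a b hab
  have h := Tuple.monotone_sort (fun i => -|x i|) hab
  simp only [Function.comp_apply, neg_le_neg_iff] at h
  exact h

/-- The weak `ℓ₂` quasi-norm `‖x‖_{2,∞}`: the minimal `M ≥ 0` such that the `k`-th largest of the
numbers `|x i|` is at most `M k^{-1/2}` for `k = 1, …, N`. -/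
def weakL2Norm {N : ℕ} (x : Fin N → ℝ) : ℝ :=
  sInf {M : ℝ | 0 ≤ M ∧
    ∀ k : Fin N, decreasingRearrangement x k ≤ M * ((k : ℝ) + 1) ^ (-(1 / 2) : ℝ)}

/-- A crude bound, used only to see that the minima below are taken over non-empty sets. -/
theorem weakL2_admissible {N : ℕ} (x : Fin N → ℝ) (R : ℝ) (hR : 0 ≤ R) (h : ∀ i, |x i| ≤ R) :
    R * (N : ℝ) ^ (1 / 2 : ℝ) ∈ {M : ℝ | 0 ≤ M ∧
      ∀ k : Fin N, decreasingRearrangement x k ≤ M * ((k : ℝ) + 1) ^ (-(1 / 2) : ℝ)} := by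
  refine ⟨by positivity, fun k => (h _).trans ?_⟩
  have hk : (0 : ℝ) < (k : ℝ) + 1 := by positivity
  have hkN : (k : ℝ) + 1 ≤ N := by exact_mod_cast k.isLt
  have h1 : (1 : ℝ) ≤ (N : ℝ) ^ (1 / 2 : ℝ) * ((k : ℝ) + 1) ^ (-(1 / 2) : ℝ) := by
    rw [Real.rpow_neg hk.le, ← div_eq_mul_inv, le_div_iff₀ (by positivity), one_mul]
    exact Real.rpow_le_rpow hk.le hkN (by norm_num)
  rw [mul_assoc]
  exact le_mul_of_one_le_right hR h1

/-- The minimum in the definition of `weakL2Norm` is attained. -/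
theorem weakL2Norm_isLeast {N : ℕ} (x : Fin N → ℝ) :
    IsLeast {M : ℝ | 0 ≤ M ∧
      ∀ k : Fin N, decreasingRearrangement x k ≤ M * ((k : ℝ) + 1) ^ (-(1 / 2) : ℝ)}
      (weakL2Norm x) := by
  have hb : BddBelow {M : ℝ | 0 ≤ M ∧
      ∀ k : Fin N, decreasingRearrangement x k ≤ M * ((k : ℝ) + 1) ^ (-(1 / 2) : ℝ)} :=
    ⟨0, fun M hM => hM.1⟩
  refine ⟨IsClosed.csInf_mem ?_ ⟨_, weakL2_admissible x ‖x‖ (norm_nonneg x)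
    (fun i => norm_le_pi_norm x i)⟩ hb, fun M hM => csInf_le hb hM⟩
  simp only [Set.ofPred_and, Set.ofPred_forall]
  exact (isClosed_le continuous_const continuous_id).inter
    (isClosed_iInter fun k => isClosed_le continuous_const (by fun_prop))

/-- The "norm" `‖A‖_{ℓ₂ → ℓ_{2,∞}}`: the minimal `M ≥ 0` such that
`‖A x‖_{2,∞} ≤ M ‖x‖₂` for all `x ∈ ℝⁿ`. -/
def ell2ToWeakL2Norm {N n : ℕ} (A : Matrix (Fin N) (Fin n) ℝ) : ℝ :=
  sInf {M : ℝ | 0 ≤ M ∧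
    ∀ x : EuclideanSpace ℝ (Fin n), weakL2Norm (A.mulVec x.ofLp) ≤ M * ‖x‖}

/-- The minimum in the definition of `ell2ToWeakL2Norm` is attained. -/
theorem ell2ToWeakL2Norm_isLeast {N n : ℕ} (A : Matrix (Fin N) (Fin n) ℝ) :
    IsLeast {M : ℝ | 0 ≤ M ∧
      ∀ x : EuclideanSpace ℝ (Fin n), weakL2Norm (A.mulVec x.ofLp) ≤ M * ‖x‖}
      (ell2ToWeakL2Norm A) := by
  have hb : BddBelow {M : ℝ | 0 ≤ M ∧
      ∀ x : EuclideanSpace ℝ (Fin n), weakL2Norm (A.mulVec x.ofLp) ≤ M * ‖x‖} :=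
    ⟨0, fun M hM => hM.1⟩
  let T : EuclideanSpace ℝ (Fin n) →L[ℝ] (Fin N → ℝ) :=
    LinearMap.toContinuousLinearMap
      (A.mulVecLin ∘ₗ (WithLp.linearEquiv 2 ℝ (Fin n → ℝ)).toLinearMap)
  have hT : ∀ x, T x = A.mulVec x.ofLp := fun x => rfl
  refine ⟨IsClosed.csInf_mem ?_ ⟨‖T‖ * (N : ℝ) ^ (1 / 2 : ℝ), by positivity, fun x => ?_⟩ hb,
    fun M hM => csInf_le hb hM⟩
  · simp only [Set.ofPred_and, Set.ofPred_forall]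
    exact (isClosed_le continuous_const continuous_id).inter
      (isClosed_iInter fun k => isClosed_le continuous_const (by fun_prop))
  · have h := (weakL2Norm_isLeast (A.mulVec x.ofLp)).2
      (weakL2_admissible (A.mulVec x.ofLp) (‖T‖ * ‖x‖) (by positivity)
        (fun i => (norm_le_pi_norm (T x) i).trans (T.le_opNorm x)))
    calc _ ≤ _ := h
      _ = _ := by ring

/-- The coordinate projection `P_I` in `ℝ^N` onto `ℝ^I`: it keeps the coordinates in `I` and
replaces the others by `0`. -/
def coordProj {N : ℕ} (I : Finset (Fin N)) : Matrix (Fin N) (Fin N) ℝ :=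
  Matrix.diagonal fun i => if i ∈ I then 1 else 0

/-- The `N × n` matrix with rows `v 0, …, v (N - 1)`. -/
def matrixOfRows {N n : ℕ} (v : Fin N → EuclideanSpace ℝ (Fin n)) : Matrix (Fin N) (Fin n) ℝ :=
  Matrix.of fun i j => v i j

end

/-! ### Deterministic reduction: sparse witnesses for large coefficients. -/

section Deterministic

/-! The weak norm is large only if some `x` has `m` coefficients `⟪X i, x⟫` that are large compared
with `‖x‖ / √m`. A supremum over all `x` does not suit a union bound, so `x` is replaced by a
direction built from the rows themselves. At the smallest size `m` where the bound fails, a signed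
sum `g` of only `⌊m/20⌋` rows is still strongly correlated with `m - 2⌊m/20⌋` rows not occurring in
it (`exists_sparse_witness`).

With the rows of `g` fixed, the remaining rows are independent of `g`. Markov's inequality for the
`q`-th moment bounds the probability for one row by some `β`, and independence bounds the joint one
by `β ^ |J|` (`measureReal_signed_sum_le`). There are at most `(2160 (N/m)²) ^ |J|` choices of
witness. The factor `(N/m) ^ (2/q)` in the threshold puts `(N/m)⁻²` into `β`, which cancels this
entropy (`entropy_mul_probability_le`). What remains is summable over `m`. -/

/-- The vector `v i` or its negative, according to a Boolean sign. -/
def signedVec {E : Type*} [NormedAddCommGroup E] {ι : Type*} (v : ι → E) (p : ι × Bool) : E :=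
  if p.2 then v p.1 else -v p.1

theorem norm_signedVec {E : Type*} [NormedAddCommGroup E] {ι : Type*} (v : ι → E) (p : ι × Bool) :
    ‖signedVec v p‖ = ‖v p.1‖ := by
  unfold signedVec; split_ifs <;> simp

variable {E : Type*} [NormedAddCommGroup E] [InnerProductSpace ℝ E]

/-- No unit vector `x` has `m` coefficients `|⟪v i, x⟫|` that all exceed `R / √m`. -/
def CoefficientBound {ι : Type*} (v : ι → E) (m : ℕ) (R : ℝ) : Prop :=
  ∀ J : Finset ι, J.card = m → ∀ (x : E) (b : ℝ), 0 ≤ b →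
    (∀ i ∈ J, b ≤ |inner ℝ (v i) x|) → b * √(m : ℝ) ≤ R * ‖x‖

theorem abs_inner_signedVec {ι : Type*} (v : ι → E) (p : ι × Bool) (x : E) :
    |inner ℝ (signedVec v p) x| = |inner ℝ (v p.1) x| := by
  unfold signedVec; split_ifs <;> simp

theorem inner_ge_of_mem_convexHull {s : Set E} {p y : E} {b : ℝ} (hp : p ∈ convexHull ℝ s)
    (h : ∀ z ∈ s, b ≤ inner ℝ z y) : b ≤ inner ℝ p y := by
  have hc : Convex ℝ {z : E | b ≤ inner ℝ z y} :=
    convex_halfSpace_ge ⟨fun a c => inner_add_left a c y, fun a c => by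
      simp [real_inner_smul_left]⟩ b
  exact convexHull_min h hc hp

/-- Some point of `s` is not on the wrong side of a point of its convex hull. -/
theorem exists_inner_le_of_mem_convexHull {s : Finset E} {p y : E}
    (hp : p ∈ convexHull ℝ (s : Set E)) : ∃ z ∈ s, inner ℝ z y ≤ inner ℝ p y := by
  have hne : s.Nonempty := by
    rw [← Finset.coe_nonempty, ← convexHull_nonempty_iff (𝕜 := ℝ)]
    exact ⟨p, hp⟩
  obtain ⟨z, hz, hmin⟩ := s.exists_min_image (fun z => inner ℝ z y) hne
  exact ⟨z, hz, inner_ge_of_mem_convexHull hp fun z' hz' => hmin z' hz'⟩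

/-- Maurey's empirical method, in a greedy form: a point of the convex hull of vectors of norm at
most `r` is approximated by an average of `d` of them. -/
theorem exists_multiset_approx {κ : Type*} [DecidableEq E] (f : κ → E) (T : Finset κ) {p : E}
    {r : ℝ} (hr : ∀ i ∈ T, ‖f i‖ ≤ r) (hp : p ∈ convexHull ℝ (T.image f : Set E)) (d : ℕ) :
    ∃ s : Multiset κ, s.card = d ∧ (∀ i ∈ s, i ∈ T) ∧
      ‖(s.map f).sum - (d : ℝ) • p‖ ^ 2 ≤ 4 * r ^ 2 * d := by
  have hpr : ‖p‖ ≤ r := by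
    have hb : convexHull ℝ (T.image f : Set E) ⊆ Metric.closedBall 0 r := by
      refine convexHull_min ?_ (convex_closedBall _ _)
      intro z hz
      obtain ⟨i, hi, rfl⟩ := Finset.mem_image.1 (Finset.mem_coe.1 hz)
      simpa using hr i hi
    simpa using hb hp
  induction d with
  | zero => exact ⟨0, by simp⟩
  | succ d ih =>
    obtain ⟨s, hs, hsT, hn⟩ := ih
    obtain ⟨z, hz, hzi⟩ := exists_inner_le_of_mem_convexHull
      (y := (s.map f).sum - (d : ℝ) • p) hp
    obtain ⟨i, hi, rfl⟩ := Finset.mem_image.1 hz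
    refine ⟨i ::ₘ s, by simp [hs], ?_, ?_⟩
    · intro k hk
      rcases Multiset.mem_cons.1 hk with rfl | hk
      exacts [hi, hsT k hk]
    -- The new vector is chosen so that `f i - p` makes a nonpositive inner product with the current
    -- error `S`; the squared error therefore grows by at most `(2r)²`.
    · set S := (s.map f).sum - (d : ℝ) • p
      have e : ((i ::ₘ s).map f).sum - ((d + 1 : ℕ) : ℝ) • p = (f i - p) + S := by
        simp only [Multiset.map_cons, Multiset.sum_cons, S]
        push_cast
        module
      have h1 : ‖f i - p‖ ≤ 2 * r := (norm_sub_le _ _).trans (by linarith [hr i hi])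
      have h2 : ‖f i - p‖ ^ 2 ≤ (2 * r) ^ 2 := pow_le_pow_left₀ (norm_nonneg _) h1 2
      have h3 : inner ℝ (f i - p) S ≤ 0 := by rw [inner_sub_left]; linarith
      rw [e, norm_add_sq_real]
      push_cast
      nlinarith

/-- The point of least norm in the convex hull of finitely many vectors. -/
theorem exists_min_norm_convexHull [DecidableEq E] (s : Finset E) (hs : s.Nonempty) :
    ∃ p ∈ convexHull ℝ (s : Set E), ∀ z ∈ s, ‖p‖ ^ 2 ≤ inner ℝ z p := by
  have hcomp : IsCompact (convexHull ℝ (s : Set E)) := s.finite_toSet.isCompact_convexHull ℝ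
  have hconv := convex_convexHull ℝ (s : Set E)
  obtain ⟨p, hp, hmin⟩ := exists_norm_eq_iInf_of_complete_convex
    (convexHull_nonempty_iff.2 hs) hcomp.isComplete hconv 0
  refine ⟨p, hp, fun z hz => ?_⟩
  have := (norm_eq_iInf_iff_real_inner_le_zero hconv hp).1 hmin z (subset_convexHull ℝ _ hz)
  simp only [zero_sub, inner_neg_left, inner_sub_right, real_inner_self_eq_norm_sq] at this
  rw [real_inner_comm]
  linarith

/-- The least-norm point `p` of the hull of the signed vectors correlates with each of them by at
least `‖p‖²`. Maurey's method replaces `d • p` by a sum `g` of `d` vectors with error `e`. The bound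
at the smaller size `d + 1`, applied to `e` itself, shows that `e` spoils at most `d` indices.
Discarding these and the indices used in `g` costs `2 * d`. -/
theorem exists_sparse_witness {ι : Type*} (v : ι → E) {r R : ℝ}
    (hr : ∀ i, ‖v i‖ ≤ r) (hr0 : 0 ≤ r) (hR : 0 < R) (hrR : 120 * r ≤ R) {m : ℕ} (hm : 20 ≤ m)
    (hlt : ∀ k < m, CoefficientBound v k R) (hfail : ¬ CoefficientBound v m R) :
    ∃ (J : Finset ι) (s : Multiset (ι × Bool)), J.card = m - 2 * (m / 20) ∧ s.card = m / 20 ∧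
      (∀ p ∈ s, p.1 ∉ J) ∧ (s.map (signedVec v)).sum ≠ 0 ∧
      ∀ i ∈ J, R / (4 * √(m : ℝ)) * ‖(s.map (signedVec v)).sum‖ ≤
        |inner ℝ (v i) (s.map (signedVec v)).sum| := by
  classical
  unfold CoefficientBound at hfail
  push Not at hfail
  obtain ⟨I, hI, x, b, hb, hbx, hbR⟩ := hfail
  set d := m / 20 with hd
  have hd1 : 1 ≤ d := by omega
  have hmd : m < 20 * (d + 1) := by omega
  have hmd' : m ≤ 40 * d := by omega
  have hIne : I.Nonempty := Finset.card_pos.1 (by omega)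
  let σ : ι → ι × Bool := fun i => (i, decide (0 ≤ inner ℝ (v i) x))
  have hσ : ∀ i, inner ℝ (signedVec v (σ i)) x = |inner ℝ (v i) x| := by
    intro i
    by_cases h : 0 ≤ inner ℝ (v i) x
    · simp [signedVec, σ, h, abs_of_nonneg]
    · simp [signedVec, σ, h, abs_of_neg (not_le.1 h)]
  let T : Finset (ι × Bool) := I.image σ
  have hTne : (T.image (signedVec v)).Nonempty := (hIne.image _).image _
  obtain ⟨p, hp, hpmin⟩ := exists_min_norm_convexHull _ hTne
  have hm0 : (0 : ℝ) < m := by exact_mod_cast (by omega : 0 < m)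
  have hsm : 0 < √(m : ℝ) := Real.sqrt_pos.2 hm0
  have hbp : b ≤ ‖p‖ * ‖x‖ := by
    refine (inner_ge_of_mem_convexHull (b := b) (y := x) hp ?_).trans (real_inner_le_norm p x)
    intro z hz
    obtain ⟨q, hq, rfl⟩ := Finset.mem_image.1 (Finset.mem_coe.1 hz)
    obtain ⟨i, hi, rfl⟩ := Finset.mem_image.1 hq
    rw [hσ]; exact hbx i hi
  -- The failing vector `x` separates the hull from the origin, so the hull stays at distance more
  -- than `R / √m`.
  have hμ : R < ‖p‖ * √(m : ℝ) := by
    by_contra hcon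
    push Not at hcon
    have := mul_le_mul_of_nonneg_right hcon (norm_nonneg x)
    nlinarith [mul_le_mul_of_nonneg_right hbp hsm.le]
  have hμ0 : 0 < ‖p‖ := by
    by_contra hcon
    nlinarith
  have hμ2 : R ^ 2 ≤ ‖p‖ ^ 2 * m := by
    calc R ^ 2 ≤ (‖p‖ * √(m : ℝ)) ^ 2 := pow_le_pow_left₀ hR.le hμ.le 2
      _ = _ := by rw [mul_pow, Real.sq_sqrt hm0.le]
  obtain ⟨s, hscard, hsT, hs⟩ := exists_multiset_approx (signedVec v) T (r := r)
    (fun q _ => by rw [norm_signedVec]; exact hr _) hp d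
  set g := (s.map (signedVec v)).sum with hg
  set e := g - (d : ℝ) • p with he
  have hd0 : (1 : ℝ) ≤ d := by exact_mod_cast hd1
  have hmdR : (m : ℝ) ≤ 40 * d := by exact_mod_cast hmd'
  have hmdR' : (m : ℝ) ≤ 20 * (d + 1) := by exact_mod_cast hmd.le
  have hge : g = (d : ℝ) • p + e := by simp [he]
  -- the number of indices spoiled by the approximation error
  let B : Finset ι := I.filter fun i => d * ‖p‖ ^ 2 / 2 ≤ |inner ℝ (v i) e|
  have hB : B.card ≤ d := by
    by_contra hcon
    obtain ⟨B', hB'B, hB'⟩ := Finset.exists_subset_card_eq (show d + 1 ≤ B.card by omega)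
    have h1 := hlt (d + 1) (by omega) B' hB' e (d * ‖p‖ ^ 2 / 2) (by positivity)
      (fun i hi => (Finset.mem_filter.1 (hB'B hi)).2)
    have h2 : (d * ‖p‖ ^ 2 / 2) ^ 2 * (d + 1) ≤ R ^ 2 * (4 * r ^ 2 * d) := by
      calc (d * ‖p‖ ^ 2 / 2) ^ 2 * ((d : ℝ) + 1)
          = (d * ‖p‖ ^ 2 / 2 * √((d + 1 : ℕ) : ℝ)) ^ 2 := by
            rw [mul_pow _ √_, Real.sq_sqrt (by positivity)]; push_cast; ring
        _ ≤ (R * ‖e‖) ^ 2 := pow_le_pow_left₀ (by positivity) h1 2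
        _ = R ^ 2 * ‖e‖ ^ 2 := by ring
        _ ≤ _ := by gcongr
    have h3 : (R ^ 2) ^ 2 ≤ (‖p‖ ^ 2 * m) ^ 2 := pow_le_pow_left₀ (by positivity) hμ2 2
    have h4 : (m : ℝ) * m ≤ (40 * d) * (20 * (d + 1)) := by gcongr
    have h5 : (d : ℝ) * (d + 1) * (‖p‖ ^ 2) ^ 2 ≤ 16 * (R ^ 2 * r ^ 2) := by
      have : (d : ℝ) * (d * (d + 1) * (‖p‖ ^ 2) ^ 2) ≤ d * (16 * (R ^ 2 * r ^ 2)) := by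
        linarith
      exact le_of_mul_le_mul_left this (by linarith)
    have h6 : (R ^ 2) ^ 2 ≤ 12800 * (R ^ 2 * r ^ 2) := by
      calc (R ^ 2) ^ 2 ≤ (‖p‖ ^ 2) ^ 2 * (m * m) := by linarith
        _ ≤ (‖p‖ ^ 2) ^ 2 * ((40 * d) * (20 * (d + 1))) := by gcongr
        _ = 800 * ((d : ℝ) * (d + 1) * (‖p‖ ^ 2) ^ 2) := by ring
        _ ≤ _ := by linarith
    have h7 : R ^ 2 ≤ 12800 * r ^ 2 := by
      have : R ^ 2 * R ^ 2 ≤ R ^ 2 * (12800 * r ^ 2) := by linarith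
      exact le_of_mul_le_mul_left this (by positivity)
    -- The contradiction is `120² = 14400 > 12800`.
    nlinarith [pow_le_pow_left₀ (by positivity) hrR 2, pow_pos hR 2]
  have hgn : ‖g‖ ≤ 2 * d * ‖p‖ := by
    have h1 : ‖e‖ ≤ d * ‖p‖ := by
      refine le_of_sq_le_sq ?_ (by positivity)
      have : 4 * r ^ 2 ≤ d * ‖p‖ ^ 2 := by
        have h2 := pow_le_pow_left₀ (by positivity) hrR 2
        have h3 : ‖p‖ ^ 2 * m ≤ ‖p‖ ^ 2 * (40 * d) := by gcongr
        nlinarith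
      calc ‖e‖ ^ 2 ≤ 4 * r ^ 2 * d := hs
        _ ≤ d * ‖p‖ ^ 2 * d := by gcongr
        _ = _ := by ring
    calc ‖g‖ ≤ ‖(d : ℝ) • p‖ + ‖e‖ := by rw [hge]; exact norm_add_le _ _
      _ ≤ _ := by rw [norm_smul]; simp; linarith
  let S : Finset ι := s.toFinset.image Prod.fst
  have hS : S.card ≤ d := by
    calc S.card ≤ s.toFinset.card := Finset.card_image_le
      _ ≤ s.card := Multiset.toFinset_card_le s
      _ = d := hscard
  have hcard : m - 2 * d ≤ ((I \ B) \ S).card := by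
    have h1 := Finset.le_card_sdiff B I
    have h2 := Finset.le_card_sdiff S (I \ B)
    omega
  obtain ⟨J, hJ, hJcard⟩ := Finset.exists_subset_card_eq hcard
  have hJin : ∀ i ∈ J, d * ‖p‖ ^ 2 / 2 ≤ |inner ℝ (v i) g| := by
    intro i hi
    have hi' := hJ hi
    simp only [Finset.mem_sdiff, B, Finset.mem_filter, not_and, not_le] at hi'
    obtain ⟨⟨hiI, hiB⟩, -⟩ := hi'
    have h1 := hiB hiI
    have h2 : ‖p‖ ^ 2 ≤ inner ℝ (signedVec v (σ i)) p :=
      hpmin _ (Finset.mem_image_of_mem _ (Finset.mem_image_of_mem _ hiI))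
    have h3 : |inner ℝ (signedVec v (σ i)) e| = |inner ℝ (v i) e| :=
      abs_inner_signedVec v (σ i) e
    have h4 : |inner ℝ (signedVec v (σ i)) g| = |inner ℝ (v i) g| :=
      abs_inner_signedVec v (σ i) g
    rw [← h4]
    refine le_trans ?_ (le_abs_self _)
    rw [hge, inner_add_right, real_inner_smul_right]
    have h5 := neg_abs_le (inner ℝ (signedVec v (σ i)) e)
    rw [h3] at h5
    have h6 := mul_le_mul_of_nonneg_left h2 (by linarith : (0 : ℝ) ≤ d)
    linarith
  refine ⟨J, s, hJcard, hscard, ?_, ?_, ?_⟩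
  · intro q hq hqJ
    have := hJ hqJ
    exact (Finset.mem_sdiff.1 this).2
      (Finset.mem_image_of_mem _ (Multiset.mem_toFinset.2 hq))
  · obtain ⟨i, hi⟩ := Finset.card_pos.1 (show 0 < J.card by omega)
    intro h0
    have := hJin i hi
    rw [hg, h0, inner_zero_right, abs_zero] at this
    have : 0 < d * ‖p‖ ^ 2 / 2 := by positivity
    linarith
  · intro i hi
    refine le_trans ?_ (hJin i hi)
    have h1 : R / (4 * √(m : ℝ)) ≤ ‖p‖ / 4 := by
      rw [div_le_div_iff₀ (by positivity) (by norm_num)]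
      linarith
    calc R / (4 * √(m : ℝ)) * ‖g‖ ≤ ‖p‖ / 4 * (2 * d * ‖p‖) := by gcongr
      _ = _ := by ring

/-- For sizes with `m / 20 = 0` no sparse sum is available, but Cauchy–Schwarz suffices. -/
theorem coefficientBound_of_card_lt {ι : Type*} (v : ι → E) {r R : ℝ} (hr : ∀ i, ‖v i‖ ≤ r)
    (hr0 : 0 ≤ r) (hR : 0 ≤ R) (hrR : 120 * r ≤ R) {m : ℕ} (hm : m < 20) :
    CoefficientBound v m R := by
  intro J hJ x b hb hJb
  rcases J.eq_empty_or_nonempty with rfl | ⟨i, hi⟩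
  · have : m = 0 := by simpa using hJ.symm
    subst this
    simpa using mul_nonneg hR (norm_nonneg x)
  · have h1 : b ≤ r * ‖x‖ := (hJb i hi).trans ((abs_real_inner_le_norm _ _).trans (by
      gcongr; exact hr i))
    have h2 : √(m : ℝ) ≤ 5 := by
      rw [Real.sqrt_le_left (by norm_num)]
      have : (m : ℝ) < 20 := by exact_mod_cast hm
      linarith
    calc b * √(m : ℝ) ≤ (r * ‖x‖) * 5 := by gcongr
      _ ≤ 120 * r * ‖x‖ := by nlinarith [mul_nonneg hr0 (norm_nonneg x)]
      _ ≤ _ := by gcongr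

theorem CoefficientBound.mono {ι : Type*} {v : ι → E} {m : ℕ} {R R' : ℝ}
    (h : CoefficientBound v m R) (hR : R ≤ R') : CoefficientBound v m R' :=
  fun J hJ x b hb hJb => (h J hJ x b hb hJb).trans (by gcongr)

/-- Strong induction on `m`; monotonicity of `R` turns the bounds at smaller sizes into bounds with
the single constant `R m`. -/
theorem coefficientBound_of_no_sparse_witness {N : ℕ} (v : Fin N → E) {r : ℝ} (R : ℕ → ℝ)
    (hr : ∀ i, ‖v i‖ ≤ r) (hr0 : 0 ≤ r) (hR0 : ∀ m, 0 ≤ R m)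
    (hR : ∀ m, 0 < m → m ≤ N → 0 < R m)
    (hmono : ∀ k m, k ≤ m → m ≤ N → R k ≤ R m) (hrR : ∀ m, 120 * r ≤ R m)
    (hno : ∀ m, 20 ≤ m → m ≤ N → ∀ (J : Finset (Fin N)) (s : Multiset (Fin N × Bool)),
      J.card = m - 2 * (m / 20) → s.card = m / 20 → (∀ p ∈ s, p.1 ∉ J) →
      (s.map (signedVec v)).sum ≠ 0 →
      ¬ ∀ i ∈ J, R m / (4 * √(m : ℝ)) * ‖(s.map (signedVec v)).sum‖ ≤
        |inner ℝ (v i) (s.map (signedVec v)).sum|) (m : ℕ) (hmN : m ≤ N) :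
    CoefficientBound v m (R m) := by
  induction m using Nat.strong_induction_on with
  | _ m ih =>
    by_cases hm : m < 20
    · exact coefficientBound_of_card_lt v hr hr0 (hR0 m) (hrR m) hm
    · push Not at hm
      by_contra hfail
      obtain ⟨J, s, hJ, hs, hd, hne, hall⟩ := exists_sparse_witness v hr hr0
        (hR m (by omega) hmN) (hrR m) hm
        (fun k hk => (ih k hk (by omega)).mono (hmono k m hk.le hmN)) hfail
      exact hno m hm hmN J s hJ hs hd hne hall

end Deterministic

/-! ### From coefficient bounds to the weak norm. -/

section WeakNorm

theorem mulVec_coordProj_mul_matrixOfRows {N n : ℕ} (v : Fin N → EuclideanSpace ℝ (Fin n))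
    (I : Finset (Fin N)) (x : EuclideanSpace ℝ (Fin n)) (i : Fin N) :
    (coordProj I * matrixOfRows v).mulVec x.ofLp i = if i ∈ I then inner ℝ (v i) x else 0 := by
  simp only [coordProj, matrixOfRows, Matrix.mulVec, dotProduct, Matrix.diagonal_mul,
    Matrix.of_apply, PiLp.inner_apply]
  split_ifs <;> simp [mul_comm]

theorem ell2ToWeakL2Norm_coordProj_le {N n : ℕ} (v : Fin N → EuclideanSpace ℝ (Fin n))
    (I : Finset (Fin N)) {R : ℝ} (hR : 0 ≤ R) (h : ∀ m ≤ I.card, CoefficientBound v m R) :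
    ell2ToWeakL2Norm (coordProj I * matrixOfRows v) ≤ R := by
  refine (ell2ToWeakL2Norm_isLeast _).2 ⟨hR, fun x => (weakL2Norm_isLeast _).2
    ⟨by positivity, fun k => ?_⟩⟩
  set y := (coordProj I * matrixOfRows v).mulVec x.ofLp with hy
  have hyi : ∀ i, y i = if i ∈ I then inner ℝ (v i) x else 0 :=
    mulVec_coordProj_mul_matrixOfRows v I x
  set b := decreasingRearrangement y k with hb
  have hb0 : 0 ≤ b := abs_nonneg _
  -- Only for `b > 0` do the largest entries all lie in `I`, since `y` vanishes off `I`.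
  rcases hb0.eq_or_lt with h0 | hpos
  · rw [← h0]; positivity
  let J : Finset (Fin N) := (Finset.Iic k).map (Tuple.sort fun i => -|y i|).toEmbedding
  have hJ : ∀ i ∈ J, b ≤ |y i| := by
    intro i hi
    obtain ⟨l, hl, rfl⟩ := Finset.mem_map.1 hi
    exact decreasingRearrangement_antitone y (Finset.mem_Iic.1 hl)
  have hJI : ∀ i ∈ J, i ∈ I := by
    intro i hi
    by_contra hiI
    have := hJ i hi
    rw [hyi, if_neg hiI, abs_zero] at this
    linarith
  have hJcard : J.card = (k : ℕ) + 1 := by simp [J]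
  have hbound := h ((k : ℕ) + 1) (hJcard ▸ Finset.card_le_card hJI) J hJcard x b hb0
    (fun i hi => by
      have := hJ i hi
      rwa [hyi, if_pos (hJI i hi)] at this)
  have hk : (0 : ℝ) < (k : ℝ) + 1 := by positivity
  rw [Real.rpow_neg hk.le, ← Real.sqrt_eq_rpow, ← div_eq_mul_inv,
    le_div_iff₀ (Real.sqrt_pos.2 hk)]
  exact_mod_cast hbound

end WeakNorm

/-! ### Correlation of independent rows with a random direction. -/

section Probability

theorem measureReal_le_abs_inner_le {Ω : Type*} [MeasurableSpace Ω] {P : Measure Ω}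
    [IsProbabilityMeasure P] {E : Type*} [NormedAddCommGroup E] [InnerProductSpace ℝ E]
    [MeasurableSpace E] [BorelSpace E] [SecondCountableTopology E] {Y : Ω → E}
    (hY : Measurable Y) {r L q a : ℝ} (hr : ∀ᵐ ω ∂P, ‖Y ω‖ ≤ r) (hq : 0 < q) (ha : 0 < a)
    (hmom : ∀ x : E, ‖x‖ = 1 → (∫ ω, |inner ℝ (Y ω) x| ^ q ∂P) ^ (1 / q) ≤ L)
    {u : E} (hu : u ≠ 0) :
    P.real {ω | a * ‖u‖ ≤ |inner ℝ (Y ω) u|} ≤ (L / a) ^ q := by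
  have hu0 : 0 < ‖u‖ := norm_pos_iff.2 hu
  set x : E := ‖u‖⁻¹ • u with hx
  have hx1 : ‖x‖ = 1 := by rw [hx, norm_smul, norm_inv, norm_norm, inv_mul_cancel₀ hu0.ne']
  set f : Ω → ℝ := fun ω => |inner ℝ (Y ω) x| ^ q with hf
  have hf0 : ∀ ω, 0 ≤ f ω := fun ω => Real.rpow_nonneg (abs_nonneg _) _
  have hfm : Measurable f := by
    have : Measurable fun ω => (inner ℝ (Y ω) x : ℝ) := hY.inner measurable_const
    fun_prop
  -- The norm bound is needed here: for a non-integrable `f` the integral would be `0` and the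
  -- moment hypothesis empty.
  have hint : Integrable f P := by
    refine Integrable.of_bound hfm.aestronglyMeasurable (r ^ q) ?_
    filter_upwards [hr] with ω hω
    rw [Real.norm_of_nonneg (hf0 ω)]
    refine Real.rpow_le_rpow (abs_nonneg _) ?_ hq.le
    calc _ ≤ ‖Y ω‖ * ‖x‖ := abs_real_inner_le_norm _ _
      _ ≤ r := by rw [hx1, mul_one]; exact hω
  have hI0 : 0 ≤ ∫ ω, f ω ∂P := integral_nonneg hf0
  have hL : 0 ≤ L := (Real.rpow_nonneg hI0 _).trans (hmom x hx1)
  have hI : ∫ ω, f ω ∂P ≤ L ^ q := by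
    have := Real.rpow_le_rpow (Real.rpow_nonneg hI0 _) (hmom x hx1) hq.le
    rwa [← Real.rpow_mul hI0, one_div_mul_cancel hq.ne', Real.rpow_one] at this
  have hset : {ω | a * ‖u‖ ≤ |inner ℝ (Y ω) u|} ⊆ {ω | a ^ q ≤ f ω} := by
    intro ω hω
    refine Real.rpow_le_rpow ha.le ?_ hq.le
    rw [hx, real_inner_smul_right, abs_mul, abs_inv, abs_norm, inv_mul_eq_div, le_div_iff₀ hu0]
    exact hω
  have hmk := mul_meas_ge_le_integral_of_nonneg (ae_of_all P hf0) hint (a ^ q)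
  rw [Real.div_rpow hL ha.le, le_div_iff₀ (Real.rpow_pos_of_pos ha q), mul_comm]
  calc _ ≤ a ^ q * P.real {ω | a ^ q ≤ f ω} := by
        exact mul_le_mul_of_nonneg_left (measureReal_mono hset) (by positivity)
    _ ≤ _ := hmk.trans hI

theorem measurable_multiset_map_sum {Ω κ E : Type*} [MeasurableSpace Ω] [NormedAddCommGroup E]
    [MeasurableSpace E] [BorelSpace E] [SecondCountableTopology E] {f : κ → Ω → E}
    (hf : ∀ k, Measurable (f k)) (s : Multiset κ) :
    Measurable fun ω => (s.map fun k => f k ω).sum := by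
  induction s using Multiset.induction_on with
  | empty => simp
  | cons k s ih => 
    simp only [Multiset.map_cons, Multiset.sum_cons]
    exact (hf k).add ih

theorem measurable_signedVec {Ω ι E : Type*} [MeasurableSpace Ω] [NormedAddCommGroup E]
    [MeasurableSpace E] [BorelSpace E] {f : ι → Ω → E}
    (hf : ∀ k, Measurable (f k)) (p : ι × Bool) :
    Measurable fun ω => signedVec (fun i => f i ω) p := by
  unfold signedVec
  split_ifs
  exacts [hf _, (hf _).neg]

/-- Independent vectors are simultaneously correlated with a direction that depends on the other
vectors with probability at most the product of the individual probabilities. -/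
theorem measureReal_forall_le_abs_inner_le {Ω : Type*} [MeasurableSpace Ω] {P : Measure Ω}
    [IsProbabilityMeasure P] {E : Type*} [NormedAddCommGroup E] [InnerProductSpace ℝ E]
    [MeasurableSpace E] [BorelSpace E] [SecondCountableTopology E] {ι : Type*}
    {X : ι → Ω → E} (hX : ∀ i, Measurable (X i)) (hind : iIndepFun X P)
    {J S : Finset ι} (hJS : Disjoint S J) {G : (S → E) → E} (hG : Measurable G) {a β : ℝ} (hβ0 : 0 ≤ β)
    (hβ : ∀ i, ∀ u : E, u ≠ 0 → P.real {ω | a * ‖u‖ ≤ |inner ℝ (X i ω) u|} ≤ β) :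
    P.real {ω | G (fun i => X i ω) ≠ 0 ∧ ∀ i ∈ J, a * ‖G (fun i => X i ω)‖ ≤
      |inner ℝ (X i ω) (G fun i => X i ω)|} ≤ β ^ J.card := by
  let XS : Ω → (S → E) := fun ω i => X i ω
  let XJ : Ω → (J → E) := fun ω i => X i ω
  have hXS : Measurable XS := by fun_prop
  have hXJ : Measurable XJ := by fun_prop
  let D : Set ((S → E) × (J → E)) :=
    {z | G z.1 ≠ 0} ∩ ⋂ i : J, {z | a * ‖G z.1‖ ≤ |inner ℝ (z.2 i) (G z.1)|}
  have hD : MeasurableSet D := by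
    have hG1 : Measurable fun z : (S → E) × (J → E) => G z.1 := hG.comp measurable_fst
    refine (hG1 (measurableSet_singleton 0).compl).inter (MeasurableSet.iInter fun i => ?_)
    have h2 : Measurable fun z : (S → E) × (J → E) => z.2 i := by fun_prop
    have h3 : Measurable fun z : (S → E) × (J → E) => (inner ℝ (z.2 i) (G z.1) : ℝ) :=
      h2.inner hG1
    exact measurableSet_le (by fun_prop) (by fun_prop)
  have hset : {ω | G (fun i => X i ω) ≠ 0 ∧ ∀ i ∈ J, a * ‖G (fun i => X i ω)‖ ≤
      |inner ℝ (X i ω) (G fun i => X i ω)|} = (fun ω => (XS ω, XJ ω)) ⁻¹' D := by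
    ext ω
    simp [D, XS, XJ]
  have hprod := (hind.indepFun_finset S J hJS hX).map_prod_eq_prod_map_map
    hXS.aemeasurable hXJ.aemeasurable
  have hPS : IsProbabilityMeasure (P.map XS) := Measure.isProbabilityMeasure_map hXS.aemeasurable
  have hPJ : IsProbabilityMeasure (P.map XJ) := Measure.isProbabilityMeasure_map hXJ.aemeasurable
  -- For fixed `y` the direction `G y` is deterministic, so the section is an intersection of
  -- independent events; Fubini then integrates over `y`.
  have hsec : ∀ y : S → E, (P.map XJ) (Prod.mk y ⁻¹' D) ≤ ENNReal.ofReal (β ^ J.card) := by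
    intro y
    by_cases hy : G y = 0
    · have : Prod.mk y ⁻¹' D = ∅ := by ext z; simp [D, hy]
      simp [this]
    · rw [Measure.map_apply hXJ (measurable_prodMk_left hD)]
      have h1 : XJ ⁻¹' (Prod.mk y ⁻¹' D) =
          ⋂ i ∈ J, X i ⁻¹' {z | a * ‖G y‖ ≤ |inner ℝ z (G y)|} := by
        ext ω; simp [D, XJ, hy]
      rw [h1, hind.measure_inter_preimage_eq_mul J (fun i _ => ?_)]
      · rw [ENNReal.ofReal_pow hβ0]
        refine Finset.prod_le_pow_card _ _ _ fun i _ => ?_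
        have := hβ i (G y) hy
        rw [Set.preimage_ofPred_eq, ← ENNReal.ofReal_toReal (measure_ne_top P _)]
        exact ENNReal.ofReal_le_ofReal this
      · exact measurableSet_le measurable_const (by fun_prop)
  have hfin : P ((fun ω => (XS ω, XJ ω)) ⁻¹' D) ≤ ENNReal.ofReal (β ^ J.card) := by
    rw [← Measure.map_apply (hXS.prodMk hXJ) hD]
    calc P.map (fun ω => (XS ω, XJ ω)) D = ((P.map XS).prod (P.map XJ)) D := by rw [← hprod]
      _ = ∫⁻ y, (P.map XJ) (Prod.mk y ⁻¹' D) ∂(P.map XS) := Measure.prod_apply hD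
      _ ≤ ∫⁻ _, ENNReal.ofReal (β ^ J.card) ∂(P.map XS) := lintegral_mono hsec
      _ = _ := by simp
  rw [hset]
  exact ENNReal.toReal_le_of_le_ofReal (by positivity) hfin

/-- The special case of `measureReal_forall_le_abs_inner_le` in which the direction is a signed
sum of some of the other vectors. -/
theorem measureReal_signed_sum_le {Ω : Type*} [MeasurableSpace Ω] {P : Measure Ω}
    [IsProbabilityMeasure P] {E : Type*} [NormedAddCommGroup E] [InnerProductSpace ℝ E]
    [MeasurableSpace E] [BorelSpace E] [SecondCountableTopology E] {ι : Type*} [Fintype ι]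
    {X : ι → Ω → E} (hX : ∀ i, Measurable (X i)) (hind : iIndepFun X P)
    {J : Finset ι} {s : Multiset (ι × Bool)} (hJs : ∀ p ∈ s, p.1 ∉ J) {a β : ℝ} (hβ0 : 0 ≤ β)
    (hβ : ∀ i, ∀ u : E, u ≠ 0 → P.real {ω | a * ‖u‖ ≤ |inner ℝ (X i ω) u|} ≤ β) :
    P.real {ω | (s.map (signedVec fun i => X i ω)).sum ≠ 0 ∧
      ∀ i ∈ J, a * ‖(s.map (signedVec fun i => X i ω)).sum‖ ≤
        |inner ℝ (X i ω) (s.map (signedVec fun i => X i ω)).sum|} ≤ β ^ J.card := by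
  classical
  let S : Finset ι := Finset.univ \ J
  -- The default `0` on `J` is never read, because `s` uses no index of `J`.
  let ext : (S → E) → ι → E := fun y i => if h : i ∈ S then y ⟨i, h⟩ else 0
  let G : (S → E) → E := fun y => (s.map (signedVec (ext y))).sum
  have hext : ∀ i, Measurable fun y => ext y i := by
    intro i
    by_cases h : i ∈ S
    · simp only [ext, h, dite_true]; fun_prop
    · simp only [ext, h, dite_false]; fun_prop
  have hG : Measurable G :=
    measurable_multiset_map_sum (fun p => measurable_signedVec (f := fun i y => ext y i) hext p) s
  have hGX : ∀ ω, G (fun i => X i ω) = (s.map (signedVec fun i => X i ω)).sum := by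
    intro ω
    refine congrArg Multiset.sum (Multiset.map_congr rfl fun p hp => ?_)
    have : p.1 ∈ S := by simp [S, hJs p hp]
    simp [signedVec, ext, this]
  have := measureReal_forall_le_abs_inner_le hX hind
    (show Disjoint S J from Finset.sdiff_disjoint) hG hβ0 hβ
  simpa only [hGX] using this

theorem measurableSet_signed_sum {Ω : Type*} [MeasurableSpace Ω]
    {E : Type*} [NormedAddCommGroup E] [InnerProductSpace ℝ E]
    [MeasurableSpace E] [BorelSpace E] [SecondCountableTopology E] {ι : Type*}
    {X : ι → Ω → E} (hX : ∀ i, Measurable (X i)) (J : Finset ι) (s : Multiset (ι × Bool))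
    (a : ℝ) :
    MeasurableSet {ω | (s.map (signedVec fun i => X i ω)).sum ≠ 0 ∧
      ∀ i ∈ J, a * ‖(s.map (signedVec fun i => X i ω)).sum‖ ≤
        |inner ℝ (X i ω) (s.map (signedVec fun i => X i ω)).sum|} := by
  have hg : Measurable fun ω => (s.map (signedVec fun i => X i ω)).sum :=
    measurable_multiset_map_sum (fun p => measurable_signedVec hX p) s
  simp only [Set.ofPred_and, Set.ofPred_forall]
  refine (hg (measurableSet_singleton 0).compl).inter ?_
  refine J.measurableSet_biInter fun i _ => ?_
  have h3 : Measurable fun ω =>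
      (inner ℝ (X i ω) (s.map (signedVec fun i => X i ω)).sum : ℝ) := (hX i).inner hg
  exact measurableSet_le (by fun_prop) (by fun_prop)

end Probability

/-! ### Entropy of the witnesses against their probability. -/

section Counting

theorem choose_le_three_mul_div_pow (n k : ℕ) (hk : 0 < k) :
    (n.choose k : ℝ) ≤ (3 * n / k) ^ k := by
  have hk0 : (0 : ℝ) < k := by exact_mod_cast hk
  have hf : (0 : ℝ) < (k.factorial : ℝ) := by exact_mod_cast k.factorial_pos
  have h1 : (k : ℝ) ^ k / k.factorial ≤ 3 ^ k := by
    refine (Real.pow_div_factorial_le_exp _ hk0.le k).trans ?_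
    rw [← Real.exp_one_pow]
    exact pow_le_pow_left₀ (Real.exp_pos 1).le
      (Real.exp_one_lt_d9.le.trans (by norm_num)) k
  calc (n.choose k : ℝ) ≤ (n : ℝ) ^ k / k.factorial := Nat.choose_le_pow_div k n
    _ = (n / k : ℝ) ^ k * ((k : ℝ) ^ k / k.factorial) := by
      rw [div_pow]; field_simp
    _ ≤ (n / k : ℝ) ^ k * 3 ^ k := by gcongr
    _ = _ := by rw [← mul_pow]; congr 1; ring

/-- The number of pairs of a set `J` of size `m - 2 ⌊m / 20⌋` and a signed multiset of size
`⌊m / 20⌋`. -/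
theorem choose_mul_multichoose_le {m N : ℕ} (hm : 20 ≤ m) (hmN : m ≤ N) :
    (N.choose (m - 2 * (m / 20)) : ℝ) * ((2 * N).multichoose (m / 20) : ℝ) ≤
      (2160 * ((N : ℝ) / m) ^ 2) ^ (m - 2 * (m / 20)) := by
  set d := m / 20 with hd
  set j := m - 2 * d with hj
  have hd1 : 0 < d := by omega
  have hm0 : (0 : ℝ) < m := by exact_mod_cast (by omega : 0 < m)
  have hj0 : (0 : ℝ) < j := by exact_mod_cast (by omega : 0 < j)
  have hd0 : (0 : ℝ) < d := by exact_mod_cast hd1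
  have hmj : (m : ℝ) ≤ 2 * j := by exact_mod_cast (by omega : m ≤ 2 * j)
  have hmd : (m : ℝ) ≤ 40 * d := by exact_mod_cast (by omega : m ≤ 40 * d)
  have hNm : 1 ≤ (N : ℝ) / m := by rw [le_div_iff₀ hm0, one_mul]; exact_mod_cast hmN
  have h1 : (N.choose j : ℝ) ≤ (6 * ((N : ℝ) / m)) ^ j := by
    refine (choose_le_three_mul_div_pow N j (by omega)).trans ?_
    refine pow_le_pow_left₀ (by positivity) ?_ j
    rw [← mul_div_assoc, div_le_div_iff₀ hj0 hm0]
    nlinarith [mul_le_mul_of_nonneg_left hmj (Nat.cast_nonneg (α := ℝ) N)]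
  -- The base `9 N / d` is at most `360 N / m` since `m ≤ 40 d`; the exponent may grow from `d` to
  -- `j` since the base is at least `1`. Together with the `6` of `h1` this gives `2160 = 6 * 360`.
  have h2 : ((2 * N).multichoose d : ℝ) ≤ (360 * ((N : ℝ) / m)) ^ j := by
    have h3 : ((2 * N).multichoose d : ℝ) ≤ ((3 * N).choose d : ℝ) := by
      rw [Nat.multichoose_eq]
      exact_mod_cast Nat.choose_le_choose d (by omega)
    refine h3.trans ((choose_le_three_mul_div_pow (3 * N) d hd1).trans ?_)
    calc (3 * ((3 * N : ℕ) : ℝ) / d) ^ d ≤ (360 * ((N : ℝ) / m)) ^ d := by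
          refine pow_le_pow_left₀ (by positivity) ?_ d
          push_cast
          rw [← mul_div_assoc, div_le_div_iff₀ hd0 hm0]
          nlinarith [mul_le_mul_of_nonneg_left hmd (Nat.cast_nonneg (α := ℝ) N)]
      _ ≤ _ := pow_le_pow_right₀ (by linarith) (by omega)
  calc _ ≤ (6 * ((N : ℝ) / m)) ^ j * (360 * ((N : ℝ) / m)) ^ j := by gcongr
    _ = _ := by rw [← mul_pow]; congr 1; ring

theorem entropy_mul_probability_le {m N : ℕ} (hm : 20 ≤ m) (hmN : m ≤ N) {q t : ℝ} (hq : 4 < q)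
    (ht : 1 ≤ t) :
    (N.choose (m - 2 * (m / 20)) : ℝ) * ((2 * N).multichoose (m / 20) : ℝ) *
      ((1 / (2160 * t * ((N : ℝ) / m) ^ (2 / q))) ^ q) ^ (m - 2 * (m / 20)) ≤
      (1 / 2) ^ m * t ^ (-(0.9 * q)) := by
  have hm0 : (0 : ℝ) < m := by exact_mod_cast (by omega : 0 < m)
  have hNm : 1 ≤ (N : ℝ) / m := by rw [le_div_iff₀ hm0, one_mul]; exact_mod_cast hmN
  have ht0 : 0 < t := by linarith
  set x := (N : ℝ) / m with hx
  set j := m - 2 * (m / 20) with hj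
  have hx0 : 0 < x := by linarith
  -- The `x ^ 2` cancels the entropy exactly, and `q > 4` leaves a surplus factor `2160⁻³` for each
  -- element of `J`.
  have hβ : (1 / (2160 * t * x ^ (2 / q))) ^ q ≤ 1 / (2160 ^ 4 * x ^ 2) * t ^ (-q) := by
    rw [Real.div_rpow zero_le_one (by positivity), Real.one_rpow,
      Real.mul_rpow (by positivity) (by positivity), Real.mul_rpow (by norm_num) ht0.le,
      ← Real.rpow_mul hx0.le, div_mul_cancel₀ _ (by linarith), Real.rpow_neg ht0.le]
    have h4 : (2160 : ℝ) ^ 4 ≤ 2160 ^ q := by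
      rw [← Real.rpow_natCast]
      exact Real.rpow_le_rpow_of_exponent_le (by norm_num) (by norm_num; exact hq.le)
    have htq : 0 < t ^ q := Real.rpow_pos_of_pos ht0 q
    rw [Real.rpow_two, ← one_div, div_mul_div_comm, one_mul]
    apply one_div_le_one_div_of_le (by positivity)
    calc (2160 : ℝ) ^ 4 * x ^ 2 * t ^ q ≤ 2160 ^ q * x ^ 2 * t ^ q := by gcongr
      _ = _ := by ring
  have htq0 : 0 < t ^ (-q) := Real.rpow_pos_of_pos ht0 _
  have htq1 : t ^ (-q) ≤ 1 := Real.rpow_le_one_of_one_le_of_nonpos ht (by linarith)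
  calc _ ≤ (2160 * x ^ 2) ^ j * (1 / (2160 ^ 4 * x ^ 2) * t ^ (-q)) ^ j := by
        gcongr
        exact choose_mul_multichoose_le hm hmN
    _ = ((1 / 2160 ^ 3 : ℝ)) ^ j * (t ^ (-q)) ^ j := by
        rw [← mul_pow, ← mul_pow]; congr 1; field_simp
    _ ≤ (1 / 4) ^ j * t ^ (-q) := by
        gcongr
        · norm_num
        · exact pow_le_of_le_one htq0.le htq1 (by omega)
    -- The decay in `t` obtained here is `t ^ (-q)`, stronger than the exponent `0.9 * q` kept
    -- below; `m ≤ 2 * j` converts the geometric factor.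
    _ = (1 / 2) ^ (2 * j) * t ^ (-q) := by rw [pow_mul]; norm_num
    _ ≤ _ := by
        gcongr ?_ * ?_
        · exact pow_le_pow_of_le_one (by norm_num) (by norm_num) (by omega)
        · exact Real.rpow_le_rpow_of_exponent_le ht (by linarith)

end Counting

/-! ### Union bound over witnesses and the main theorem. -/

section Main

/-- The second term of the bound on index sets of size `m`. -/
noncomputable def tailTerm (N : ℕ) (q : ℝ) (m : ℕ) : ℝ := √(m : ℝ) * ((N : ℝ) / m) ^ (2 / q)

theorem tailTerm_nonneg (N : ℕ) (q : ℝ) (m : ℕ) : 0 ≤ tailTerm N q m := by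
  unfold tailTerm; positivity

/-- For `m > 0` the term is `N ^ (2/q) * m ^ (1/2 - 2/q)`, whose exponent in `m` is nonnegative as
`q > 4`. Both the induction on `m` and the passage from size `m` to `I.card` rest on this. -/
theorem tailTerm_mono (N : ℕ) {q : ℝ} (hq : 4 < q) {k m : ℕ} (hkm : k ≤ m) :
    tailTerm N q k ≤ tailTerm N q m := by
  rcases k.eq_zero_or_pos with rfl | hk
  · simpa [tailTerm] using tailTerm_nonneg N q m
  have key : ∀ l : ℕ, 0 < l →
      tailTerm N q l = (N : ℝ) ^ (2 / q) * (l : ℝ) ^ (1 / 2 - 2 / q) := by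
    intro l hl
    have hl0 : (0 : ℝ) < l := by exact_mod_cast hl
    rw [tailTerm, Real.sqrt_eq_rpow, Real.div_rpow (by positivity) hl0.le, Real.rpow_sub hl0]
    ring
  rw [key k hk, key m (by omega)]
  have h2 : 2 / q ≤ 1 / 2 := by
    rw [div_le_div_iff₀ (by linarith) (by norm_num)]; linarith
  gcongr

/-- The bad event: some signed sum of few rows is a direction with which many other rows are
strongly correlated. -/
def badEvent {Ω : Type*} {N n : ℕ} (X : Fin N → Ω → EuclideanSpace ℝ (Fin n)) (a : ℝ)
    (J : Finset (Fin N)) (s : Multiset (Fin N × Bool)) : Set Ω :=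
  {ω | (s.map (signedVec fun i => X i ω)).sum ≠ 0 ∧
    ∀ i ∈ J, a * ‖(s.map (signedVec fun i => X i ω)).sum‖ ≤
      |inner ℝ (X i ω) (s.map (signedVec fun i => X i ω)).sum|}

open Classical in
/-- The disjoint pairs of a set and a signed multiset that witness a large coefficient bound at
size `m`. -/
def witnessPairs (N m : ℕ) : Finset (Finset (Fin N) × Sym (Fin N × Bool) (m / 20)) :=
  (Finset.powersetCard (m - 2 * (m / 20)) Finset.univ ×ˢ Finset.univ).filter
    fun z => ∀ p ∈ (z.2 : Multiset (Fin N × Bool)), p.1 ∉ z.1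

theorem card_witnessPairs_le (N m : ℕ) : ((witnessPairs N m).card : ℝ) ≤
    (N.choose (m - 2 * (m / 20)) : ℝ) * ((2 * N).multichoose (m / 20) : ℝ) := by
  have h : (witnessPairs N m).card ≤
      N.choose (m - 2 * (m / 20)) * (2 * N).multichoose (m / 20) := by
    refine (Finset.card_filter_le _ _).trans (le_of_eq ?_)
    rw [Finset.card_product, Finset.card_powersetCard, Finset.card_univ, Finset.card_univ,
      Sym.card_sym_eq_multichoose]
    simp [mul_comm]
  exact_mod_cast h

theorem measureReal_bad_le {n N : ℕ} {Ω : Type*} [MeasurableSpace Ω] {P : Measure Ω}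
    [IsProbabilityMeasure P] {X : Fin N → Ω → EuclideanSpace ℝ (Fin n)}
    (hX : ∀ i, Measurable (X i)) (hind : iIndepFun X P) {r L q t : ℝ}
    (hr : ∀ i, ∀ᵐ ω ∂P, ‖X i ω‖ ≤ r) (hL : 0 < L) (hq : 4 < q) (ht : 1 ≤ t)
    (hmom : ∀ i, ∀ x : EuclideanSpace ℝ (Fin n), ‖x‖ = 1 →
        (∫ ω, |inner ℝ (X i ω) x| ^ q ∂P) ^ (1 / q) ≤ L) {m : ℕ} (hm : 20 ≤ m) (hmN : m ≤ N) :
    P.real (⋃ z ∈ witnessPairs N m,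
      badEvent X (L * (2160 * t * ((N : ℝ) / m) ^ (2 / q))) z.1 z.2) ≤
      (1 / 2) ^ m * t ^ (-(0.9 * q)) := by
  have hN0 : (0 : ℝ) < N := by exact_mod_cast (by omega : 0 < N)
  have hm0 : (0 : ℝ) < m := by exact_mod_cast (by omega : 0 < m)
  set y := 2160 * t * ((N : ℝ) / m) ^ (2 / q) with hy
  have hy0 : 0 < y := by positivity
  have hβ : ∀ i, ∀ u : EuclideanSpace ℝ (Fin n), u ≠ 0 →
      P.real {ω | L * y * ‖u‖ ≤ |inner ℝ (X i ω) u|} ≤ (1 / y) ^ q := by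
    intro i u hu
    have := measureReal_le_abs_inner_le (hX i) (hr i) (by linarith : 0 < q)
      (mul_pos hL hy0) (hmom i) hu
    rwa [div_mul_eq_div_div, div_self hL.ne'] at this
  calc _ ≤ ∑ z ∈ witnessPairs N m, P.real (badEvent X (L * y) z.1 z.2) :=
        measureReal_biUnion_finset_le _ _
    _ ≤ ∑ z ∈ witnessPairs N m, ((1 / y) ^ q) ^ (m - 2 * (m / 20)) := by
        refine Finset.sum_le_sum fun z hz => ?_
        simp only [witnessPairs, Finset.mem_filter, Finset.mem_product,
          Finset.mem_powersetCard] at hz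
        have := measureReal_signed_sum_le hX hind hz.2 (by positivity) hβ
        rwa [hz.1.1.2] at this
    _ = (witnessPairs N m).card * ((1 / y) ^ q) ^ (m - 2 * (m / 20)) := by
        rw [Finset.sum_const, nsmul_eq_mul]
    _ ≤ _ := by
        gcongr
        exact card_witnessPairs_le N m
    _ ≤ _ := entropy_mul_probability_le hm hmN hq ht

/-- Off the bad events, all the coefficient bounds hold. -/
theorem coefficientBound_of_notMem_badEvent {n N : ℕ} {Ω : Type*}
    {X : Fin N → Ω → EuclideanSpace ℝ (Fin n)} {κ r L q t c : ℝ} (hκ : 0 < κ)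
    (hrκ : r = κ * √(n : ℝ)) (hL : 0 < L)
    (hq : 4 < q) (ht : 1 ≤ t) (hc : c = 8640 * L + 120 * κ) {ω : Ω} (hr : ∀ i, ‖X i ω‖ ≤ r)
    (hω : ∀ m, 20 ≤ m → m ≤ N → ∀ z ∈ witnessPairs N m,
      ω ∉ badEvent X (L * (2160 * t * ((N : ℝ) / m) ^ (2 / q))) z.1 z.2) (m : ℕ) (hm : m ≤ N) :
    CoefficientBound (fun i => X i ω) m (c * (√(n : ℝ) + t * tailTerm N q m)) := by
  have hc0 : 0 < c := by rw [hc]; positivity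
  have ht0 : 0 < t := by linarith
  have htail : ∀ m, 0 ≤ t * tailTerm N q m := fun m => mul_nonneg ht0.le (tailTerm_nonneg _ _ _)
  refine coefficientBound_of_no_sparse_witness (fun i => X i ω) (r := r)
    (fun m => c * (√(n : ℝ) + t * tailTerm N q m)) hr (by rw [hrκ]; positivity)
    (fun m => mul_nonneg hc0.le (add_nonneg (Real.sqrt_nonneg _) (htail m)))
    (fun m hm0 hmN => ?_) (fun k m hkm _ => ?_) (fun m => ?_) ?_ m hm
  · have h1 : (0 : ℝ) < m := by exact_mod_cast hm0
    have h2 : (0 : ℝ) < N := by exact_mod_cast (by omega : 0 < N)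
    have : 0 < tailTerm N q m := by unfold tailTerm; positivity
    positivity
  · have := tailTerm_mono N hq hkm
    gcongr
  · have h1 : 120 * r ≤ c * √(n : ℝ) := by
      rw [hrκ, hc]
      nlinarith [mul_nonneg hL.le (Real.sqrt_nonneg (n : ℝ))]
    nlinarith [mul_nonneg hc0.le (htail m)]
  · intro m hm hmN J s hJ hs hdisj hne hall
    refine hω m hm hmN (J, ⟨s, hs⟩) ?_ ⟨hne, fun i hi => ?_⟩
    · simp only [witnessPairs, Finset.mem_filter, Finset.mem_product, Finset.mem_powersetCard]
      exact ⟨⟨⟨Finset.subset_univ _, hJ⟩, Finset.mem_univ _⟩, hdisj⟩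
    · refine le_trans ?_ (hall i hi)
      have hsm : 0 < √(m : ℝ) := Real.sqrt_pos.2 (by exact_mod_cast (by omega : 0 < m))
      refine mul_le_mul_of_nonneg_right ?_ (norm_nonneg _)
      rw [le_div_iff₀ (by positivity)]
      -- Here `8640 = 4 * 2160`: the `4` is the loss in the sparse witness, the `2160` comes from
      -- the entropy count.
      calc L * (2160 * t * ((N : ℝ) / m) ^ (2 / q)) * (4 * √(m : ℝ))
          = 8640 * L * (t * tailTerm N q m) := by unfold tailTerm; ring
        _ ≤ c * (t * tailTerm N q m) := by
          refine mul_le_mul_of_nonneg_right ?_ (htail m)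
          rw [hc]; linarith
        _ ≤ _ := by
          refine mul_le_mul_of_nonneg_left ?_ hc0.le
          linarith [Real.sqrt_nonneg (n : ℝ)]

theorem coordProj_univ (N : ℕ) : coordProj (Finset.univ : Finset (Fin N)) = 1 := by
  simp [coordProj]

theorem tailTerm_self (N : ℕ) {q : ℝ} : tailTerm N q N = √(N : ℝ) := by
  rcases N.eq_zero_or_pos with rfl | hN
  · simp [tailTerm]
  · have : (N : ℝ) ≠ 0 := by positivity
    simp [tailTerm, div_self this]

theorem theorem3p1 :
    -- an absolute constant
    ∃ C : ℝ, 0 < C ∧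
    ∀ K L q : ℝ, 4 < q →
    -- a constant that depends only on `K`, `L`, `q`
    ∃ C' : ℝ, 0 < C' ∧
    ∀ (n N : ℕ) (Ω : Type*) [MeasurableSpace Ω] (P : Measure Ω) [IsProbabilityMeasure P]
      (X : Fin N → Ω → EuclideanSpace ℝ (Fin n)),
      (∀ i, Measurable (X i)) →
      iIndepFun X P →
      (∀ i, ∀ᵐ ω ∂P, ‖X i ω‖ ≤ K * √(n : ℝ)) →
      -- the integrand is bounded almost surely, hence integrable
      (∀ i, ∀ x : EuclideanSpace ℝ (Fin n), ‖x‖ = 1 →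
        (∫ ω, |inner ℝ (X i ω) x| ^ q ∂P) ^ (1 / q) ≤ L) →
      ∀ t : ℝ, 1 ≤ t →
        ∃ E : Set Ω, MeasurableSet E ∧ 1 - C * t ^ (-(0.9 * q)) ≤ P.real E ∧
          ∀ ω ∈ E,
            (∀ I : Finset (Fin N),
              ell2ToWeakL2Norm (coordProj I * matrixOfRows fun i => X i ω) ≤
                C' * (√(n : ℝ) + t * √(I.card : ℝ) * ((N : ℝ) / (I.card : ℝ)) ^ (2 / q))) ∧
            ell2ToWeakL2Norm (matrixOfRows fun i => X i ω) ≤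
              C' * (√(n : ℝ) + t * √(N : ℝ)) := by
  -- The constant `2` bounds the geometric series over `m`.
  refine ⟨2, two_pos, fun K L q hq => ?_⟩
  -- `K` and `L` may be zero or negative; the maxima make the thresholds positive.
  set κ := max K 1 with hκ
  set Λ := max L 1 with hΛ
  have hκ0 : 0 < κ := lt_max_of_lt_right one_pos
  have hΛ0 : 0 < Λ := lt_max_of_lt_right one_pos
  refine ⟨8640 * Λ + 120 * κ, by positivity, ?_⟩
  intro n N Ω _ P _ X hX hind hK hL t ht
  have hK' : ∀ i, ∀ᵐ ω ∂P, ‖X i ω‖ ≤ κ * √(n : ℝ) := fun i => by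
    filter_upwards [hK i] with ω hω
    exact hω.trans (by gcongr; exact le_max_left _ _)
  have hL' : ∀ i, ∀ x : EuclideanSpace ℝ (Fin n), ‖x‖ = 1 →
      (∫ ω, |inner ℝ (X i ω) x| ^ q ∂P) ^ (1 / q) ≤ Λ :=
    fun i x hx => (hL i x hx).trans (le_max_left _ _)
  let B : Set Ω := ⋃ m ∈ Finset.Icc 20 N, ⋃ z ∈ witnessPairs N m,
      badEvent X (Λ * (2160 * t * ((N : ℝ) / m) ^ (2 / q))) z.1 z.2
  have hBmeas : MeasurableSet B := by
    refine Finset.measurableSet_biUnion _ fun m _ => Finset.measurableSet_biUnion _ fun z _ => ?_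
    exact measurableSet_signed_sum hX _ _ _
  -- The deterministic part needs the norm bounds at the given `ω`; they hold on this event of full
  -- measure.
  let F : Set Ω := {ω | ∀ i, ‖X i ω‖ ≤ κ * √(n : ℝ)}
  have hFmeas : MeasurableSet F := by
    simp only [F, Set.ofPred_forall]
    exact MeasurableSet.iInter fun i => measurableSet_le (hX i).norm measurable_const
  have hFae : ∀ᵐ ω ∂P, ω ∈ F := ae_all_iff.2 hK'
  have ht0 : 0 ≤ t ^ (-(0.9 * q)) := Real.rpow_nonneg (by linarith) _
  have hB : P.real B ≤ 2 * t ^ (-(0.9 * q)) := by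
    calc P.real B ≤ ∑ m ∈ Finset.Icc 20 N, (1 / 2) ^ m * t ^ (-(0.9 * q)) := by
          refine (measureReal_biUnion_finset_le _ _).trans (Finset.sum_le_sum fun m hm => ?_)
          exact measureReal_bad_le hX hind hK' hΛ0 hq ht hL' (Finset.mem_Icc.1 hm).1
            (Finset.mem_Icc.1 hm).2
      _ = (∑ m ∈ Finset.Icc 20 N, (1 / 2 : ℝ) ^ m) * t ^ (-(0.9 * q)) := by
          rw [Finset.sum_mul]
      _ ≤ 2 * t ^ (-(0.9 * q)) := by
          gcongr
          refine le_trans (Finset.sum_le_sum_of_subset_of_nonneg (t := Finset.range (N + 1))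
            (fun m hm => ?_) (fun m _ _ => by positivity)) (sum_geometric_two_le (N + 1))
          simp only [Finset.mem_Icc, Finset.mem_range] at hm ⊢
          omega
  refine ⟨F ∩ Bᶜ, hFmeas.inter hBmeas.compl, ?_, fun ω hω => ?_⟩
  · have h1 : P.real (F ∩ Bᶜ) = P.real Bᶜ :=
      measureReal_congr (by
        filter_upwards [hFae] with ω hω
        exact propext ⟨fun h => h.2, fun h => ⟨hω, h⟩⟩)
    rw [h1, probReal_compl_eq_one_sub hBmeas]
    linarith
  · have hcoef := coefficientBound_of_notMem_badEvent (X := X) hκ0 rfl hΛ0 hq ht rfl hω.1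
      (fun m hm hmN z hz hmem => hω.2 (by
        simp only [B, Set.mem_iUnion]
        exact ⟨m, Finset.mem_Icc.2 ⟨hm, hmN⟩, z, hz, hmem⟩))
    have hmain : ∀ I : Finset (Fin N),
        ell2ToWeakL2Norm (coordProj I * matrixOfRows fun i => X i ω) ≤
          (8640 * Λ + 120 * κ) * (√(n : ℝ) + t * tailTerm N q I.card) := by
      intro I
      have hI : I.card ≤ N := by simpa using I.card_le_univ
      refine ell2ToWeakL2Norm_coordProj_le _ I ?_ fun m hm => (hcoef m (hm.trans hI)).mono ?_
      · have := tailTerm_nonneg N q I.card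
        positivity
      · have := tailTerm_mono N hq hm
        gcongr
    refine ⟨fun I => ?_, ?_⟩
    -- For empty `I` the factor `√0 = 0` kills the second term, whatever the value of `N / 0`.
    · simpa only [tailTerm, mul_assoc] using hmain I
    · have := hmain Finset.univ
      rwa [coordProj_univ, Matrix.one_mul, Finset.card_univ, Fintype.card_fin, tailTerm_self] at this

end Main
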